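/- Let $n$ be a nonnegative integer and let $g,g_1,g_2,g_3,g_4>0$. Put $$v(z)=\frac{\sin(z+ig)}{\sin z},\qquad w(z)=\frac{\sin(z+ig_1)\cos(z+ig_2)\sin(z+ig_3)\cos(z+ig_4)}{\sin^2 z\,\cos^2 z},$$ $$V_j(\mathbf x)=w(x_j)\prod_{1\le k\le n,\,k\ne j}v(x_j+x_k)\,v(x_j-x_k),$$ $$H(\mathbf p,\mathbf x)=\sum_{j=1}^n\Bigl(\cosh(p_j)\sqrt{V_j(\mathbf x)V_j(-\mathbf x)}-\tfrac12\bigl(V_j(\mathbf x)+V_j(-\mathbf x)\bigr)\Bigr),$$ and let $\Omega=\{(\mathbf p,\mathbf x)\in\mathbb R^{2n}: 0<x_1<x_2<\cdots<x_n<\pi/2\}$. Then $H$ is real-valued and nonnegative on $\Omega$, and it attains the value $0$ at exactly one point of $\Omega$. Moreover, a point $(\mathbf p,\mathbf x)\in\Omega$ satisfies $H(\mathbf p,\mathbf x)=0$ if and only if $p_1=\cdots=p_n=0$ and, for $j=1,\dots,n$, $$\prod_{1\le k\le n,\,k\ne j}\frac{\sin(x_j+x_k+ig)\sin(x_j-x_k+ig)}{\sin(x_j+x_k-ig)\sin(x_j-x_k-ig)}=\frac{\sin(x_j-ig_1)\cos(x_j-ig_2)\sin(x_j-ig_3)\cos(x_j-ig_4)}{\sin(x_j+ig_1)\cos(x_j+ig_2)\sin(x_j+ig_3)\cos(x_j+ig_4)}.$$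 -/

import Mathlib

namespace RuijsenaarsBC

noncomputable section

/-- The pair potential `v(z) = sin(z + i g) / sin z`. -/
def pairPotential (g : ℝ) (z : ℂ) : ℂ :=
  Complex.sin (z + Complex.I * g) / Complex.sin z

/-- The external potential `w(z)` with couplings `g₁, g₂, g₃, g₄`. -/
def extPotential (g₁ g₂ g₃ g₄ : ℝ) (z : ℂ) : ℂ :=
  (Complex.sin (z + Complex.I * g₁) * Complex.cos (z + Complex.I * g₂) *
      Complex.sin (z + Complex.I * g₃) * Complex.cos (z + Complex.I * g₄)) /
    (Complex.sin z ^ 2 * Complex.cos z ^ 2)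

/-- `V_j(x) = w(x_j) ∏_{k ≠ j} v(x_j + x_k) v(x_j - x_k)`. -/
def V {n : ℕ} (g g₁ g₂ g₃ g₄ : ℝ) (j : Fin n) (x : Fin n → ℝ) : ℂ :=
  extPotential g₁ g₂ g₃ g₄ (x j) *
    ∏ k ∈ Finset.univ.erase j,
      (pairPotential g ((x j : ℂ) + x k) * pairPotential g ((x j : ℂ) - x k))

/-- The Hamiltonian
`H(p, x) = ∑_j (cosh(p_j) √(V_j(x) V_j(-x)) - (V_j(x) + V_j(-x)) / 2)`, as a complex number;
the square root is the principal one. -/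
def hamiltonian {n : ℕ} (g g₁ g₂ g₃ g₄ : ℝ) (p x : Fin n → ℝ) : ℂ :=
  ∑ j : Fin n,
    ((Real.cosh (p j) : ℂ) *
        (V g g₁ g₂ g₃ g₄ j x * V g g₁ g₂ g₃ g₄ j (-x)) ^ (1 / 2 : ℂ) -
      (V g g₁ g₂ g₃ g₄ j x + V g g₁ g₂ g₃ g₄ j (-x)) / 2)

/-- The phase space of all `(p, x) ∈ ℝⁿ × ℝⁿ` with `0 < x_1 < x_2 < ⋯ < x_n < π / 2`. -/
def phaseSpace (n : ℕ) : Set ((Fin n → ℝ) × (Fin n → ℝ)) :=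
  {P | StrictMono P.2 ∧ ∀ j, 0 < P.2 j ∧ P.2 j < Real.pi / 2}

/-- The system of algebraic equations for the equilibrium positions. -/
def IsBetheSolution {n : ℕ} (g g₁ g₂ g₃ g₄ : ℝ) (x : Fin n → ℝ) : Prop :=
  ∀ j : Fin n,
    ∏ k ∈ Finset.univ.erase j,
        ((Complex.sin ((x j : ℂ) + x k + Complex.I * g) *
            Complex.sin ((x j : ℂ) - x k + Complex.I * g)) /
          (Complex.sin ((x j : ℂ) + x k - Complex.I * g) *
            Complex.sin ((x j : ℂ) - x k - Complex.I * g))) =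
      (Complex.sin ((x j : ℂ) - Complex.I * g₁) * Complex.cos ((x j : ℂ) - Complex.I * g₂) *
          Complex.sin ((x j : ℂ) - Complex.I * g₃) * Complex.cos ((x j : ℂ) - Complex.I * g₄)) /
        (Complex.sin ((x j : ℂ) + Complex.I * g₁) * Complex.cos ((x j : ℂ) + Complex.I * g₂) *
          Complex.sin ((x j : ℂ) + Complex.I * g₃) * Complex.cos ((x j : ℂ) + Complex.I * g₄))

end

end RuijsenaarsBC

namespace RuijsenaarsBC

/-! For real `x`, replacing `x` by `-x` conjugates `V_j`, so `H = ∑ (cosh(p_j) |V_j| - Re V_j)`.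
Each summand is nonnegative and vanishes exactly when `p_j = 0` and `V_j` is a positive real (`V_j ≠
0` on the phase space). Everything then rests on the argument of `V_j`.

Write `sin(x + ig) = i r exp(-iF(x))` with `r > 0` and `F` odd, increasing and shifted by `π` under
`x ↦ x + π`. The external factor has a similar phase `W`. With `Ξ_j` the `bethePhase`, counting
signs gives `V_j = r exp(i(π(j+1) - Ξ_j))` for zero-based `j` (`V_eq`), while the Bethe equations
say `Ξ_j ∈ πℤ` (`isBetheSolution_iff`). In the alcove the `Ξ_j` increase strictly with `j` and lie
between `0` and `π(n+1)`, so either condition forces `Ξ_j = π(j+1)` (`bethePhase_eq_of_int`).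

This last system is the critical point equation of a convex potential. Monotonicity of its gradient
gives uniqueness (`bethePhase_injective`). Minimising over the closed cube gives existence
(`exists_bethePhase_eq`), since the signs of `Ξ_j - π(j+1)` on the faces exclude boundary minima. -/

/-- The phase `W(x_j) + ∑_{k ≠ j} (F(x_j + x_k) + F(x_j - x_k))` of the `j`-th Bethe equation. -/
def bethePhase {n : ℕ} (F W : ℝ → ℝ) (x : Fin n → ℝ) (j : Fin n) : ℝ :=
  W (x j) + ∑ k ∈ Finset.univ.erase j, (F (x j + x k) + F (x j - x k))

/-! ### Abstract phases: monotonicity, bounds and quantisation. -/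

section BethePhase

variable {n : ℕ} {F W : ℝ → ℝ}

/-- Exchanging `j` and `k` and using oddness of `F` symmetrises the double sum. In this form `F` is
paired with the increment of its own argument, which serves both the monotonicity and the gradient
computation. -/
theorem sum_bethePhase_mul (hF : ∀ x, F (-x) = -F x) (x h : Fin n → ℝ) :
    ∑ j, bethePhase F W x j * h j =
      ∑ j, (W (x j) * h j + ∑ k ∈ Finset.univ.erase j,
        (F (x j + x k) * (h j + h k) + F (x j - x k) * (h j - h k)) / 2) := by
  have hswap : ∑ j, ∑ k ∈ Finset.univ.erase j, (F (x j + x k) + F (x j - x k)) * h j =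
      ∑ j, ∑ k ∈ Finset.univ.erase j, (F (x j + x k) - F (x j - x k)) * h k := by
    rw [Finset.sum_comm' (t' := Finset.univ) (s' := fun k => Finset.univ.erase k)
      (by intro a b; simp [ne_comm])]
    refine Finset.sum_congr rfl fun j _ => Finset.sum_congr rfl fun k _ => ?_
    rw [← neg_sub (x j) (x k), hF, add_comm (x k)]
    ring
  have hsplit : ∑ j, ∑ k ∈ Finset.univ.erase j,
        (F (x j + x k) * (h j + h k) + F (x j - x k) * (h j - h k)) / 2 =
      (∑ j, ∑ k ∈ Finset.univ.erase j, (F (x j + x k) + F (x j - x k)) * h j +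
        ∑ j, ∑ k ∈ Finset.univ.erase j, (F (x j + x k) - F (x j - x k)) * h k) / 2 := by
    rw [← Finset.sum_add_distrib, Finset.sum_div]
    refine Finset.sum_congr rfl fun j _ => ?_
    rw [← Finset.sum_add_distrib, Finset.sum_div]
    exact Finset.sum_congr rfl fun k _ => by ring
  rw [Finset.sum_add_distrib, hsplit, ← hswap, add_self_div_two, ← Finset.sum_add_distrib]
  refine Finset.sum_congr rfl fun j _ => ?_
  rw [bethePhase, add_mul, Finset.sum_mul]

/-- `⟨Ξ(x) - Ξ(y), x - y⟩` splits into nonnegative terms by `sum_bethePhase_mul`; the `W` term is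
positive at any coordinate where `x` and `y` differ. -/
theorem bethePhase_injective (hF : ∀ x, F (-x) = -F x) (hFm : Monotone F) (hWm : StrictMono W) :
    Function.Injective (bethePhase (n := n) F W) := by
  intro x y hxy
  have key := sum_bethePhase_mul (W := W) hF x (x - y)
  rw [hxy, sum_bethePhase_mul hF y (x - y), eq_comm, ← sub_eq_zero,
    ← Finset.sum_sub_distrib] at key
  have mono_mul : ∀ a b : ℝ, 0 ≤ (F a - F b) * (a - b) := fun a b => by
    rcases le_total a b with h | h
    · exact mul_nonneg_of_nonpos_of_nonpos (sub_nonpos.2 (hFm h)) (sub_nonpos.2 h)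
    · exact mul_nonneg (sub_nonneg.2 (hFm h)) (sub_nonneg.2 h)
  have strict_mul : ∀ a b : ℝ, a ≠ b → 0 < (W a - W b) * (a - b) := fun a b hab => by
    rcases lt_or_gt_of_ne hab with h | h
    · exact mul_pos_of_neg_of_neg (sub_neg.2 (hWm h)) (sub_neg.2 h)
    · exact mul_pos (sub_pos.2 (hWm h)) (sub_pos.2 h)
  have pair_nonneg : ∀ j, 0 ≤ ∑ k ∈ Finset.univ.erase j,
      (((F (x j + x k) * ((x - y) j + (x - y) k) + F (x j - x k) * ((x - y) j - (x - y) k)) / 2) -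
       ((F (y j + y k) * ((x - y) j + (x - y) k) +
          F (y j - y k) * ((x - y) j - (x - y) k)) / 2)) := fun j =>
    Finset.sum_nonneg fun k _ => by
      have h1 := mono_mul (x j + x k) (y j + y k)
      have h2 := mono_mul (x j - x k) (y j - y k)
      simp only [Pi.sub_apply]
      nlinarith
  have term : ∀ j, (W (x j) * (x - y) j + ∑ k ∈ Finset.univ.erase j,
        (F (x j + x k) * ((x - y) j + (x - y) k) + F (x j - x k) * ((x - y) j - (x - y) k)) / 2) -
      (W (y j) * (x - y) j + ∑ k ∈ Finset.univ.erase j,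
        (F (y j + y k) * ((x - y) j + (x - y) k) + F (y j - y k) * ((x - y) j - (x - y) k)) / 2) ≥
      (W (x j) - W (y j)) * (x j - y j) := fun j => by
    have h := pair_nonneg j
    rw [Finset.sum_sub_distrib] at h
    simp only [Pi.sub_apply] at h ⊢
    linarith
  have single_nonneg : ∀ j, 0 ≤ (W (x j) - W (y j)) * (x j - y j) := fun j => by
    rcases eq_or_ne (x j) (y j) with h | h
    · simp [h]
    · exact (strict_mul _ _ h).le
  have hzero := (Finset.sum_eq_zero_iff_of_nonneg
    fun j _ => (single_nonneg j).trans (term j)).1 key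
  funext j
  by_contra hne
  have := hzero j (Finset.mem_univ j)
  linarith [term j, strict_mul _ _ hne]

/-- The sums for `i` and `j` compare termwise once the mutual terms `k = j` and `k = i` are split
off and matched with each other. -/
theorem bethePhase_le_of_le (hFm : Monotone F) (hWm : Monotone W)
    (x : Fin n → ℝ) {i j : Fin n} (h : x i ≤ x j) : bethePhase F W x i ≤ bethePhase F W x j := by
  rcases eq_or_ne i j with rfl | hij
  · exact le_rfl
  have split : ∀ a b : Fin n, a ≠ b → bethePhase F W x a =
      W (x a) + ((F (x a + x b) + F (x a - x b)) + ∑ k ∈ (Finset.univ.erase a).erase b,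
        (F (x a + x k) + F (x a - x k))) := fun a b hab => by
    rw [bethePhase, Finset.add_sum_erase _ (fun k => F (x a + x k) + F (x a - x k))
      (Finset.mem_erase.2 ⟨hab.symm, Finset.mem_univ b⟩)]
  rw [split i j hij, split j i hij.symm, Finset.erase_right_comm]
  have h1 := hWm h
  have h2 : F (x i - x j) ≤ F (x j - x i) := hFm (by linarith)
  have h3 : ∑ k ∈ (Finset.univ.erase j).erase i, (F (x i + x k) + F (x i - x k)) ≤
      ∑ k ∈ (Finset.univ.erase j).erase i, (F (x j + x k) + F (x j - x k)) :=
    Finset.sum_le_sum fun k _ => add_le_add (hFm (by linarith)) (hFm (by linarith))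
  rw [add_comm (x j) (x i)]
  linarith

theorem bethePhase_lt_of_lt (hFm : Monotone F) (hWm : StrictMono W)
    (x : Fin n → ℝ) {i j : Fin n} (h : x i < x j) : bethePhase F W x i < bethePhase F W x j := by
  -- Taking `W = 0` isolates the pair sums; strictness then comes from the actual `W`.
  have hdiff := bethePhase_le_of_le (W := 0) hFm monotone_const x h.le
  have := hWm h
  simp only [bethePhase, Pi.zero_apply, zero_add] at hdiff ⊢
  linarith

theorem pair_le_zero (hF : ∀ x, F (-x) = -F x) (hFm : Monotone F) {a : ℝ} (ha : a ≤ 0) (b : ℝ) :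
    F (a + b) + F (a - b) ≤ 0 := by
  have h : F (a + b) ≤ F (b - a) := hFm (by linarith)
  rw [← neg_sub b a, hF]
  linarith

theorem pair_nonneg (hF : ∀ x, F (-x) = -F x) (hFm : Monotone F) {a : ℝ} (ha : 0 ≤ a) (b : ℝ) :
    0 ≤ F (a + b) + F (a - b) := by
  have h := pair_le_zero hF hFm (neg_nonpos.2 ha) b
  rw [show -a + b = -(a - b) by ring, show -a - b = -(a + b) by ring, hF, hF] at h
  linarith

/-- By oddness `F(a - b) = -F(b - a)`, and `a + b` exceeds `b - a` by at least one period `π`. -/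
theorem pi_le_pair (hF : ∀ x, F (-x) = -F x) (hFm : Monotone F)
    (hFp : ∀ x, F (x + Real.pi) = F x + Real.pi) {a : ℝ} (ha : Real.pi / 2 ≤ a) (b : ℝ) :
    Real.pi ≤ F (a + b) + F (a - b) := by
  have h : F (b - a + Real.pi) ≤ F (a + b) := hFm (by linarith)
  rw [hFp] at h
  rw [← neg_sub b a, hF]
  linarith

theorem pair_le_pi (hF : ∀ x, F (-x) = -F x) (hFm : Monotone F)
    (hFp : ∀ x, F (x + Real.pi) = F x + Real.pi) {a : ℝ} (ha : a ≤ Real.pi / 2) (b : ℝ) :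
    F (a + b) + F (a - b) ≤ Real.pi := by
  have h : F (a + b) ≤ F (b - a + Real.pi) := hFm (by linarith)
  rw [hFp] at h
  rw [← neg_sub b a, hF]
  linarith

theorem odd_zero {f : ℝ → ℝ} (hf : ∀ x, f (-x) = -f x) : f 0 = 0 := by
  have := hf 0
  rw [neg_zero] at this
  linarith

theorem bethePhase_pos (hF : ∀ x, F (-x) = -F x) (hFm : Monotone F) (hW : ∀ x, W (-x) = -W x)
    (hWm : StrictMono W) (x : Fin n → ℝ) {j : Fin n} (h : 0 < x j) : 0 < bethePhase F W x j := by
  have h1 := hWm h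
  rw [odd_zero hW] at h1
  exact add_pos_of_pos_of_nonneg h1 (Finset.sum_nonneg fun k _ => pair_nonneg hF hFm h.le _)

theorem bethePhase_nonpos (hF : ∀ x, F (-x) = -F x) (hFm : Monotone F) (hW : ∀ x, W (-x) = -W x)
    (hWm : StrictMono W) (x : Fin n → ℝ) {j : Fin n} (h : x j ≤ 0) : bethePhase F W x j ≤ 0 := by
  have h1 := hWm.monotone h
  rw [odd_zero hW] at h1
  exact add_nonpos h1 (Finset.sum_nonpos fun k _ => pair_le_zero hF hFm h _)

theorem card_erase_mul_pi (j : Fin n) :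
    ∑ _k ∈ Finset.univ.erase j, Real.pi = Real.pi * n - Real.pi := by
  have : 1 ≤ n := j.pos
  rw [Finset.sum_const, Finset.card_erase_of_mem (Finset.mem_univ j), Finset.card_univ,
    Fintype.card_fin, nsmul_eq_mul, Nat.cast_sub this]
  push_cast
  ring

theorem bethePhase_lt (hF : ∀ x, F (-x) = -F x) (hFm : Monotone F)
    (hFp : ∀ x, F (x + Real.pi) = F x + Real.pi) (hWm : StrictMono W)
    (hWp : W (Real.pi / 2) = 2 * Real.pi) (x : Fin n → ℝ) {j : Fin n} (h : x j < Real.pi / 2) :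
    bethePhase F W x j < Real.pi * (n + 1) := by
  have h1 := hWm h
  have h2 : ∑ k ∈ Finset.univ.erase j, (F (x j + x k) + F (x j - x k)) ≤
      ∑ _k ∈ Finset.univ.erase j, Real.pi :=
    Finset.sum_le_sum fun k _ => pair_le_pi hF hFm hFp h.le _
  rw [card_erase_mul_pi] at h2
  rw [bethePhase]
  linarith

theorem le_bethePhase (hF : ∀ x, F (-x) = -F x) (hFm : Monotone F)
    (hFp : ∀ x, F (x + Real.pi) = F x + Real.pi) (hWm : StrictMono W)
    (hWp : W (Real.pi / 2) = 2 * Real.pi) (x : Fin n → ℝ) {j : Fin n} (h : Real.pi / 2 ≤ x j) :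
    Real.pi * (n + 1) ≤ bethePhase F W x j := by
  have h1 := hWm.monotone h
  have h2 : ∑ _k ∈ Finset.univ.erase j, Real.pi ≤
      ∑ k ∈ Finset.univ.erase j, (F (x j + x k) + F (x j - x k)) :=
    Finset.sum_le_sum fun k _ => pi_le_pair hF hFm hFp h _
  rw [card_erase_mul_pi] at h2
  rw [bethePhase]
  linarith

/-- A strictly increasing sequence of `n` integers between `1` and `n` is `1, …, n`. -/
theorem strictMono_int_eq {N : Fin n → ℤ} (hN : StrictMono N) (hpos : ∀ j, 0 < N j)
    (hlt : ∀ j, N j < n + 1) (j : Fin n) : N j = (j : ℤ) + 1 := by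
  let M : Fin n → Fin n := fun j => ⟨(N j - 1).toNat, by have := hpos j; have := hlt j; omega⟩
  have hM : StrictMono M := fun a b hab => by
    have h1 := hN hab
    have h2 := hpos a
    simp only [M, Fin.mk_lt_mk]
    omega
  -- A strictly monotone map on `Fin n` is determined by its range, and an injective self-map of a
  -- finite set is onto.
  have hid : M = id := (hM.range_inj strictMono_id).1 (by
    rw [(Finite.surjective_of_injective hM.injective).range_eq, Set.range_id])
  have h := congrArg Fin.val (congrFun hid j)
  have := hpos j
  simp only [M, id] at h
  omega

/-- In the alcove, integrality of all `Ξ_j / π` pins these integers. -/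
theorem bethePhase_eq_of_int (hF : ∀ x, F (-x) = -F x) (hFm : Monotone F)
    (hFp : ∀ x, F (x + Real.pi) = F x + Real.pi) (hW : ∀ x, W (-x) = -W x) (hWm : StrictMono W)
    (hWp : W (Real.pi / 2) = 2 * Real.pi) {x : Fin n → ℝ} (hx : StrictMono x)
    (hx' : ∀ j, 0 < x j ∧ x j < Real.pi / 2)
    (hint : ∀ j, ∃ m : ℤ, bethePhase F W x j = Real.pi * m) (j : Fin n) :
    bethePhase F W x j = Real.pi * (j + 1) := by
  choose N hN using hint
  have hpi := Real.pi_pos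
  have := strictMono_int_eq (N := N)
    (fun a b hab => by
      have h := bethePhase_lt_of_lt hFm hWm x (hx hab)
      rw [hN, hN] at h
      exact_mod_cast lt_of_mul_lt_mul_left h hpi.le)
    (fun a => by
      have h := bethePhase_pos hF hFm hW hWm x (hx' a).1
      rw [hN] at h
      exact_mod_cast pos_of_mul_pos_right h hpi.le)
    (fun a => by
      have h := bethePhase_lt hF hFm hFp hWm hWp x (hx' a).2
      rw [hN] at h
      exact_mod_cast lt_of_mul_lt_mul_left h hpi.le) j
  rw [hN, this]
  push_cast
  rfl

/-! ### Existence by minimising the potential. -/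

/-- The Yang–Yang type potential whose gradient is the Bethe phase minus `a`. -/
noncomputable def potential (F W : ℝ → ℝ) (a : Fin n → ℝ) (x : Fin n → ℝ) : ℝ :=
  ∑ j, ((∫ t in (0 : ℝ)..x j, W t) - a j * x j + ∑ k ∈ Finset.univ.erase j,
    ((∫ t in (0 : ℝ)..x j + x k, F t) + ∫ t in (0 : ℝ)..x j - x k, F t) / 2)

theorem hasDerivAt_primitive {f : ℝ → ℝ} (hf : Continuous f) (b : ℝ) :
    HasDerivAt (fun u => ∫ t in (0 : ℝ)..u, f t) (f b) b :=
  intervalIntegral.integral_hasDerivAt_right (hf.intervalIntegrable _ _)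
    (hf.stronglyMeasurableAtFilter _ _) hf.continuousAt

theorem continuous_primitive {f : ℝ → ℝ} (hf : Continuous f) :
    Continuous fun u => ∫ t in (0 : ℝ)..u, f t :=
  continuous_iff_continuousAt.2 fun b => (hasDerivAt_primitive hf b).continuousAt

theorem continuous_potential (hFc : Continuous F) (hWc : Continuous W) (a : Fin n → ℝ) :
    Continuous (potential F W a) := by
  have h1 := continuous_primitive hFc
  have h2 := continuous_primitive hWc
  unfold potential
  refine continuous_finsetSum _ fun j _ => ((h2.comp (continuous_apply j)).sub
    (continuous_const.mul (continuous_apply j))).add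
    (continuous_finsetSum _ fun k _ => ((h1.comp (by fun_prop)).add
      (h1.comp (by fun_prop))).div_const 2)

theorem hasDerivAt_potential (hF : ∀ x, F (-x) = -F x) (hFc : Continuous F) (hWc : Continuous W)
    (a x h : Fin n → ℝ) :
    HasDerivAt (fun t : ℝ => potential F W a (x + t • h))
      (∑ j, (bethePhase F W x j - a j) * h j) 0 := by
  have lin : ∀ b c : ℝ, HasDerivAt (fun t : ℝ => b + t * c) c 0 := fun b c => by
    simpa using ((hasDerivAt_id (0 : ℝ)).mul_const c).const_add b
  have prim : ∀ {f : ℝ → ℝ}, Continuous f → ∀ b c : ℝ,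
      HasDerivAt (fun t : ℝ => ∫ s in (0 : ℝ)..b + t * c, f s) (f b * c) 0 := fun {f} hf b c =>
    HasDerivAt.comp (h₂ := fun u => ∫ s in (0 : ℝ)..u, f s) (0 : ℝ)
      (by simpa using hasDerivAt_primitive hf b) (lin b c)
  have hsum : ∑ j, (bethePhase F W x j - a j) * h j =
      ∑ j, (W (x j) * h j - a j * h j + ∑ k ∈ Finset.univ.erase j,
        (F (x j + x k) * (h j + h k) + F (x j - x k) * (h j - h k)) / 2) := by
    simp only [sub_mul]
    rw [Finset.sum_sub_distrib, sum_bethePhase_mul hF, ← Finset.sum_sub_distrib]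
    exact Finset.sum_congr rfl fun j _ => by ring
  rw [hsum]
  have hfun : (fun t : ℝ => potential F W a (x + t • h)) = fun t : ℝ =>
      ∑ j, ((∫ s in (0 : ℝ)..x j + t * h j, W s) - a j * (x j + t * h j) +
        ∑ k ∈ Finset.univ.erase j, ((∫ s in (0 : ℝ)..(x j + x k) + t * (h j + h k), F s) +
          ∫ s in (0 : ℝ)..(x j - x k) + t * (h j - h k), F s) / 2) := by
    funext t
    unfold potential
    refine Finset.sum_congr rfl fun j _ => ?_
    simp only [Pi.add_apply, Pi.smul_apply, smul_eq_mul]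
    congr 1
    refine Finset.sum_congr rfl fun k _ => ?_
    congr 3 <;> ring
  rw [hfun]
  exact HasDerivAt.fun_sum fun j _ => ((prim hWc _ _).sub ((lin _ _).const_mul _)).add
    (HasDerivAt.fun_sum fun k _ => ((prim hFc _ _).add (prim hFc _ _)).div_const 2)

theorem deriv_nonneg_of_min_right {f : ℝ → ℝ} {d : ℝ} (hd : HasDerivAt f d 0)
    (hf : ∀ t ∈ Set.Ioc (0 : ℝ) 1, f 0 ≤ f t) : 0 ≤ d := by
  have hs := (hasDerivAt_iff_tendsto_slope.1 hd).mono_left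
    (nhdsWithin_mono (0 : ℝ) (s := Set.Ioi 0) fun t (ht : 0 < t) => ht.ne')
  refine ge_of_tendsto hs ?_
  filter_upwards [Ioc_mem_nhdsGT (zero_lt_one' ℝ)] with t ht
  rw [slope_def_field, sub_zero]
  exact div_nonneg (sub_nonneg.2 (hf t ht)) ht.1.le

/-- The minimum is taken over the full cube, with no ordering imposed; the increasing targets
`π(j+1)` force the ordering afterwards. -/
theorem exists_bethePhase_eq (hF : ∀ x, F (-x) = -F x) (hFm : Monotone F) (hFc : Continuous F)
    (hFp : ∀ x, F (x + Real.pi) = F x + Real.pi) (hW : ∀ x, W (-x) = -W x) (hWm : StrictMono W)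
    (hWc : Continuous W) (hWp : W (Real.pi / 2) = 2 * Real.pi) :
    ∃ x : Fin n → ℝ, StrictMono x ∧ (∀ j, 0 < x j ∧ x j < Real.pi / 2) ∧
      ∀ j, bethePhase F W x j = Real.pi * (j + 1) := by
  have hpi := Real.pi_pos
  set a : Fin n → ℝ := fun j => Real.pi * (j + 1) with ha
  have ha0 : ∀ j, 0 < a j := fun j => by positivity
  have han : ∀ j, a j < Real.pi * (n + 1) := fun j =>
    mul_lt_mul_of_pos_left (by exact_mod_cast Nat.succ_lt_succ j.2) hpi
  obtain ⟨x, hx, hmin⟩ := (isCompact_Icc (a := (0 : Fin n → ℝ))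
    (b := fun _ => Real.pi / 2)).exists_isMinOn
    ⟨0, Set.left_mem_Icc.2 fun _ => by positivity⟩ (continuous_potential hFc hWc a).continuousOn
  -- First-order condition at the minimiser when only the `j`-th coordinate moves, towards `c`. The
  -- endpoints `c = 0` and `c = π/2` suffice below.
  have var : ∀ (j : Fin n) (c : ℝ), 0 ≤ c → c ≤ Real.pi / 2 →
      0 ≤ (bethePhase F W x j - a j) * (c - x j) := fun j c hc0 hc1 => by
    have hy : Function.update x j c ∈ Set.Icc (0 : Fin n → ℝ) (fun _ => Real.pi / 2) := by
      constructor <;> intro i <;> rcases eq_or_ne i j with rfl | hij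
      · simpa using hc0
      · simpa [hij] using hx.1 i
      · simpa using hc1
      · simpa [hij] using hx.2 i
    have h := deriv_nonneg_of_min_right
      (hasDerivAt_potential (W := W) hF hFc hWc a x (Function.update x j c - x)) fun t ht => by
        have := hmin ((convex_Icc _ _).add_smul_sub_mem hx hy ⟨ht.1.le, ht.2⟩)
        simpa using this
    rwa [Finset.sum_eq_single j (fun i _ hij => by simp [hij]) (by simp), Pi.sub_apply,
      Function.update_self] at h
  have hpos : ∀ j, 0 < x j := fun j => by
    by_contra! h
    have h1 := bethePhase_nonpos hF hFm hW hWm x h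
    have h2 : x j = 0 := le_antisymm h (hx.1 j)
    have h3 := var j (Real.pi / 2) (by positivity) le_rfl
    rw [h2] at h3
    have := ha0 j
    nlinarith
  have hlt : ∀ j, x j < Real.pi / 2 := fun j => by
    by_contra! h
    have h1 := le_bethePhase hF hFm hFp hWm hWp x h
    have h2 : x j = Real.pi / 2 := le_antisymm (hx.2 j) h
    have h3 := var j 0 le_rfl (by positivity)
    rw [h2] at h3
    have := han j
    nlinarith
  have heq : ∀ j, bethePhase F W x j = a j := fun j => by
    have h1 := var j 0 le_rfl (by positivity)
    have h2 := var j (Real.pi / 2) (by positivity) le_rfl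
    have h3 := hpos j
    have h4 := hlt j
    apply le_antisymm
    · by_contra! h
      nlinarith
    · by_contra! h
      nlinarith
  refine ⟨x, fun i j hij => ?_, fun j => ⟨hpos j, hlt j⟩, heq⟩
  by_contra! h
  have h1 := bethePhase_le_of_le hFm hWm.monotone x h
  rw [heq, heq] at h1
  have h2 := le_of_mul_le_mul_left h1 hpi
  have h3 : (i : ℕ) < j := hij
  have h4 : (j : ℝ) ≤ i := by linarith
  exact absurd (Nat.cast_le.1 h4) (by omega)

end BethePhase

end RuijsenaarsBC
-- The phase of `sin(x + ig)`.
namespace RuijsenaarsBC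

/-- The continuous phase of `sin(x + i g)`: `sin(x + i g) = i r exp(-i phase g x)` with `r > 0`. -/
noncomputable def phase (g x : ℝ) : ℝ :=
  x - (Complex.log (1 - Complex.exp (2 * (x * Complex.I) - 2 * g))).im

section Phase

variable {g : ℝ}

theorem norm_exp_lt_one (hg : 0 < g) (x : ℝ) :
    ‖Complex.exp (2 * (x * Complex.I) - 2 * g)‖ < 1 := by
  rw [Complex.norm_exp]
  simpa using hg

theorem one_sub_exp_mem_slitPlane (hg : 0 < g) (x : ℝ) :
    1 - Complex.exp (2 * (x * Complex.I) - 2 * g) ∈ Complex.slitPlane := by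
  rw [sub_eq_add_neg]
  exact Complex.mem_slitPlane_of_norm_lt_one (by rw [norm_neg]; exact norm_exp_lt_one hg x)

theorem hasDerivAt_phase (hg : 0 < g) (x : ℝ) :
    HasDerivAt (phase g) (((1 + Complex.exp (2 * (x * Complex.I) - 2 * g)) /
      (1 - Complex.exp (2 * (x * Complex.I) - 2 * g))).re) x := by
  have hne := Complex.slitPlane_ne_zero (one_sub_exp_mem_slitPlane hg x)
  have h1 : HasDerivAt (fun t : ℝ => 2 * ((t : ℂ) * Complex.I) - 2 * (g : ℂ))
      (2 * Complex.I) x := by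
    simpa using (((Complex.ofRealCLM.hasDerivAt (x := x)).mul_const Complex.I).const_mul
      (2 : ℂ)).sub_const (2 * (g : ℂ))
  have h2 := (h1.cexp.const_sub 1).clog_real (one_sub_exp_mem_slitPlane hg x)
  have h3 := (hasDerivAt_id x).sub (Complex.imCLM.hasFDerivAt.comp_hasDerivAt x h2)
  refine h3.congr_deriv ?_
  set e := Complex.exp (2 * (x * Complex.I) - 2 * g)
  have h4 : (1 + e) / (1 - e) = 1 + 2 * (e / (1 - e)) := by
    field_simp
    ring
  have h5 : -(e * (2 * Complex.I)) / (1 - e) = -(2 * (e / (1 - e))) * Complex.I := by ring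
  rw [h4, h5]
  simp

/-- The Cayley map `(1 + e)/(1 - e)` sends the unit disc to the right half-plane: its real part is
`(1 - |e|²)/|1 - e|²`. -/
theorem deriv_phase_pos (hg : 0 < g) (x : ℝ) :
    0 < ((1 + Complex.exp (2 * (x * Complex.I) - 2 * g)) /
      (1 - Complex.exp (2 * (x * Complex.I) - 2 * g))).re := by
  have hne := Complex.slitPlane_ne_zero (one_sub_exp_mem_slitPlane hg x)
  have hn := norm_exp_lt_one hg x
  set e := Complex.exp (2 * (x * Complex.I) - 2 * g)
  rw [Complex.div_re, ← add_div]
  refine div_pos ?_ (Complex.normSq_pos.2 hne)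
  have : Complex.normSq e < 1 := by
    rw [Complex.normSq_eq_norm_sq]
    exact pow_lt_one₀ (norm_nonneg _) hn two_ne_zero
  rw [Complex.normSq_apply] at this
  simp only [Complex.add_re, Complex.one_re, Complex.sub_re, Complex.add_im, Complex.one_im,
    Complex.sub_im]
  linarith

theorem strictMono_phase (hg : 0 < g) : StrictMono (phase g) :=
  strictMono_of_deriv_pos fun x => by
    rw [(hasDerivAt_phase hg x).deriv]
    exact deriv_phase_pos hg x

theorem continuous_phase (hg : 0 < g) : Continuous (phase g) :=
  continuous_iff_continuousAt.2 fun x => (hasDerivAt_phase hg x).continuousAt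

theorem phase_neg (hg : 0 < g) (x : ℝ) : phase g (-x) = -phase g x := by
  have h : 1 - Complex.exp (2 * ((-x : ℝ) * Complex.I) - 2 * g) =
      (starRingEnd ℂ) (1 - Complex.exp (2 * (x * Complex.I) - 2 * g)) := by
    rw [map_sub, ← Complex.exp_conj]
    simp [Complex.conj_ofReal, Complex.conj_ofNat]
  rw [phase, phase, h, Complex.log_conj _ (Complex.slitPlane_arg_ne_pi
    (one_sub_exp_mem_slitPlane hg x)), Complex.conj_im]
  ring

theorem phase_add_pi (g x : ℝ) : phase g (x + Real.pi) = phase g x + Real.pi := by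
  have h : (2 * (((x + Real.pi : ℝ) : ℂ) * Complex.I) - 2 * g) =
      2 * (x * Complex.I) - 2 * g + 2 * Real.pi * Complex.I := by
    push_cast
    ring
  rw [phase, phase, h, Complex.exp_periodic]
  ring

theorem phase_half_pi (hg : 0 < g) : phase g (Real.pi / 2) = Real.pi / 2 := by
  have h := phase_add_pi g (-(Real.pi / 2))
  rw [phase_neg hg, show -(Real.pi / 2) + Real.pi = Real.pi / 2 by ring] at h
  linarith

/-- Factor `sin(x + ig) = (i/2) e^{g - ix} (1 - e^{2ix - 2g})`. The last factor stays in the slit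
plane, so its principal argument varies continuously. -/
theorem sin_add_eq (hg : 0 < g) (x : ℝ) : ∃ r : ℝ, 0 < r ∧
    Complex.sin (x + Complex.I * g) = r * Complex.I * Complex.exp (-(phase g x * Complex.I)) := by
  have hne := Complex.slitPlane_ne_zero (one_sub_exp_mem_slitPlane hg x)
  set u := 1 - Complex.exp (2 * (x * Complex.I) - 2 * g) with hu
  refine ⟨Real.exp g / 2 * ‖u‖, mul_pos (by positivity) (norm_pos_iff.2 hne), ?_⟩
  have h1 : Complex.sin (x + Complex.I * g) =
      Complex.exp (g - x * Complex.I) * u * Complex.I / 2 := by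
    have e1 : -(x + Complex.I * g) * Complex.I = g - x * Complex.I := by
      linear_combination (-(g : ℂ)) * Complex.I_sq
    have e2 : (x + Complex.I * g) * Complex.I =
        (g - x * Complex.I) + (2 * (x * Complex.I) - 2 * g) := by
      linear_combination (g : ℂ) * Complex.I_sq
    rw [Complex.sin, e1, e2, Complex.exp_add, hu]
    ring
  have h2 : u = ‖u‖ * Complex.exp (u.arg * Complex.I) := (Complex.norm_mul_exp_arg_mul_I u).symm
  have h3 : -((phase g x : ℝ) * Complex.I) + g = (g - x * Complex.I) + u.arg * Complex.I := by
    rw [phase, ← hu, Complex.log_im]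
    push_cast
    ring
  rw [h1]
  conv_lhs => rw [h2]
  have h4 : Complex.exp (g - x * Complex.I) * Complex.exp (u.arg * Complex.I) =
      Complex.exp g * Complex.exp (-((phase g x : ℝ) * Complex.I)) := by
    rw [← Complex.exp_add, ← h3, Complex.exp_add, mul_comm]
  push_cast
  linear_combination (‖u‖ * Complex.I / 2 : ℂ) * h4

theorem cos_add_eq (hg : 0 < g) (x : ℝ) : ∃ r : ℝ, 0 < r ∧
    Complex.cos (x + Complex.I * g) =
      r * Complex.exp (-((phase g (x + Real.pi / 2) - Real.pi / 2 : ℝ) * Complex.I)) := by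
  -- The shift by `π/2` turns sine into cosine, and subtracting `π/2` from the phase absorbs the
  -- factor `i`.
  obtain ⟨r, hr, h⟩ := sin_add_eq hg (x + Real.pi / 2)
  refine ⟨r, hr, ?_⟩
  have h1 : (((x + Real.pi / 2 : ℝ) : ℂ) + Complex.I * g) = (x + Complex.I * g) + Real.pi / 2 := by
    push_cast
    ring
  rw [h1, Complex.sin_add_pi_div_two] at h
  rw [h, show -((phase g (x + Real.pi / 2) - Real.pi / 2 : ℝ) * Complex.I) =
    Real.pi / 2 * Complex.I + -((phase g (x + Real.pi / 2) : ℝ) * Complex.I) by push_cast; ring,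
    Complex.exp_add, Complex.exp_pi_div_two_mul_I]
  ring

end Phase

/-! ### The phase of the external potential. -/

/-- The phase of the numerator of the external potential. -/
noncomputable def extPhase (g₁ g₂ g₃ g₄ x : ℝ) : ℝ :=
  phase g₁ x + (phase g₂ (x + Real.pi / 2) - Real.pi / 2) + phase g₃ x +
    (phase g₄ (x + Real.pi / 2) - Real.pi / 2)

section ExtPhase

variable {g₁ g₂ g₃ g₄ : ℝ}

theorem phase_neg_add_half_pi {g : ℝ} (hg : 0 < g) (x : ℝ) :
    phase g (-x + Real.pi / 2) = -phase g (x + Real.pi / 2) + Real.pi := by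
  rw [show -x + Real.pi / 2 = -(x + Real.pi / 2) + Real.pi by ring, phase_add_pi, phase_neg hg]

theorem extPhase_neg (hg₁ : 0 < g₁) (hg₂ : 0 < g₂) (hg₃ : 0 < g₃) (hg₄ : 0 < g₄) (x : ℝ) :
    extPhase g₁ g₂ g₃ g₄ (-x) = -extPhase g₁ g₂ g₃ g₄ x := by
  simp only [extPhase, phase_neg_add_half_pi hg₂, phase_neg_add_half_pi hg₄, phase_neg hg₁,
    phase_neg hg₃]
  ring

theorem strictMono_extPhase (hg₁ : 0 < g₁) (hg₂ : 0 < g₂) (hg₃ : 0 < g₃) (hg₄ : 0 < g₄) :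
    StrictMono (extPhase g₁ g₂ g₃ g₄) := fun x y h => by
  have h1 := strictMono_phase hg₁ h
  have h2 := strictMono_phase hg₂ (add_lt_add_left h (Real.pi / 2))
  have h3 := strictMono_phase hg₃ h
  have h4 := strictMono_phase hg₄ (add_lt_add_left h (Real.pi / 2))
  simp only [extPhase]
  linarith

theorem continuous_extPhase (hg₁ : 0 < g₁) (hg₂ : 0 < g₂) (hg₃ : 0 < g₃) (hg₄ : 0 < g₄) :
    Continuous (extPhase g₁ g₂ g₃ g₄) := by
  have h1 := continuous_phase hg₁
  have h2 := continuous_phase hg₂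
  have h3 := continuous_phase hg₃
  have h4 := continuous_phase hg₄
  unfold extPhase
  fun_prop

theorem extPhase_half_pi (hg₁ : 0 < g₁) (hg₂ : 0 < g₂) (hg₃ : 0 < g₃) (hg₄ : 0 < g₄) :
    extPhase g₁ g₂ g₃ g₄ (Real.pi / 2) = 2 * Real.pi := by
  have phase_pi : ∀ {g : ℝ}, 0 < g → phase g Real.pi = Real.pi := fun {g} hg => by
    have h := phase_add_pi g (Real.pi / 2 - Real.pi / 2)
    have h0 := phase_neg hg 0
    simp only [sub_self, zero_add, neg_zero] at h h0
    linarith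
  simp only [extPhase, phase_half_pi hg₁, phase_half_pi hg₃, add_halves, phase_pi hg₂,
    phase_pi hg₄]
  ring

theorem ext_numerator_eq (hg₁ : 0 < g₁) (hg₂ : 0 < g₂) (hg₃ : 0 < g₃) (hg₄ : 0 < g₄) (x : ℝ) :
    ∃ r : ℝ, 0 < r ∧
      Complex.sin (x + Complex.I * g₁) * Complex.cos (x + Complex.I * g₂) *
        Complex.sin (x + Complex.I * g₃) * Complex.cos (x + Complex.I * g₄) =
      -r * Complex.exp (-(extPhase g₁ g₂ g₃ g₄ x * Complex.I)) := by
  obtain ⟨r₁, h₁, e₁⟩ := sin_add_eq hg₁ x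
  obtain ⟨r₂, h₂, e₂⟩ := cos_add_eq hg₂ x
  obtain ⟨r₃, h₃, e₃⟩ := sin_add_eq hg₃ x
  obtain ⟨r₄, h₄, e₄⟩ := cos_add_eq hg₄ x
  refine ⟨r₁ * r₂ * r₃ * r₄, by positivity, ?_⟩
  have h : -((extPhase g₁ g₂ g₃ g₄ x : ℝ) * Complex.I) = -((phase g₁ x : ℝ) * Complex.I) +
      -((phase g₂ (x + Real.pi / 2) - Real.pi / 2 : ℝ) * Complex.I) +
      -((phase g₃ x : ℝ) * Complex.I) +
      -((phase g₄ (x + Real.pi / 2) - Real.pi / 2 : ℝ) * Complex.I) := by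
    rw [extPhase]
    push_cast
    ring
  rw [e₁, e₂, e₃, e₄, h, Complex.exp_add, Complex.exp_add, Complex.exp_add]
  generalize Complex.exp _ = a₁
  generalize Complex.exp _ = a₂
  generalize Complex.exp _ = a₃
  generalize Complex.exp _ = a₄
  push_cast
  linear_combination (r₁ * r₂ * r₃ * r₄ * a₁ * a₂ * a₃ * a₄ : ℂ) * Complex.I_sq

end ExtPhase

end RuijsenaarsBC
-- From the Hamiltonian and the Bethe equations to phases.
namespace RuijsenaarsBC

section Potentials

variable {g g₁ g₂ g₃ g₄ : ℝ} {n : ℕ}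

theorem sin_sub_eq_conj (g x : ℝ) :
    Complex.sin (x - Complex.I * g) = (starRingEnd ℂ) (Complex.sin (x + Complex.I * g)) := by
  rw [← Complex.sin_conj]
  congr 1
  simp [Complex.conj_ofReal, sub_eq_add_neg]

theorem cos_sub_eq_conj (g x : ℝ) :
    Complex.cos (x - Complex.I * g) = (starRingEnd ℂ) (Complex.cos (x + Complex.I * g)) := by
  rw [← Complex.cos_conj]
  congr 1
  simp [Complex.conj_ofReal, sub_eq_add_neg]

theorem pairPotential_neg (g x : ℝ) :
    pairPotential g (-x) = (starRingEnd ℂ) (pairPotential g x) := by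
  rw [pairPotential, pairPotential, map_div₀, ← sin_sub_eq_conj, ← Complex.sin_conj,
    Complex.conj_ofReal, Complex.sin_neg, show -(x : ℂ) + Complex.I * g = -(x - Complex.I * g) by
    ring, Complex.sin_neg, neg_div_neg_eq]

theorem extPotential_neg (g₁ g₂ g₃ g₄ x : ℝ) : extPotential g₁ g₂ g₃ g₄ (-x) =
    (starRingEnd ℂ) (extPotential g₁ g₂ g₃ g₄ x) := by
  have neg_add : ∀ g : ℝ, -(x : ℂ) + Complex.I * g = -(x - Complex.I * g) := fun g => by ring
  have conj_sin : (starRingEnd ℂ) (Complex.sin x) = Complex.sin x := by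
    rw [← Complex.sin_conj, Complex.conj_ofReal]
  have conj_cos : (starRingEnd ℂ) (Complex.cos x) = Complex.cos x := by
    rw [← Complex.cos_conj, Complex.conj_ofReal]
  simp only [extPotential, map_div₀, map_mul, map_pow, ← sin_sub_eq_conj, ← cos_sub_eq_conj,
    conj_sin, conj_cos, neg_add, Complex.sin_neg, Complex.cos_neg]
  ring

theorem V_neg (j : Fin n) (x : Fin n → ℝ) :
    V g g₁ g₂ g₃ g₄ j (-x) = (starRingEnd ℂ) (V g g₁ g₂ g₃ g₄ j x) := by
  rw [V, V, map_mul, map_prod]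
  congr 1
  · rw [← extPotential_neg]
    simp
  · refine Finset.prod_congr rfl fun k _ => ?_
    rw [map_mul, ← Complex.ofReal_add (x j), ← Complex.ofReal_sub (x j), ← pairPotential_neg,
      ← pairPotential_neg]
    congr 2 <;> push_cast [Pi.neg_apply] <;> ring

theorem sin_add_mul_sin_add_eq (hg : 0 < g) (a b : ℝ) : ∃ r : ℝ, 0 < r ∧
    Complex.sin (a + Complex.I * g) * Complex.sin (b + Complex.I * g) =
      ((-r : ℝ) : ℂ) * Complex.exp (-((phase g a + phase g b : ℝ) * Complex.I)) := by
  obtain ⟨r, hr, e⟩ := sin_add_eq hg a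
  obtain ⟨s, hs, f⟩ := sin_add_eq hg b
  refine ⟨r * s, mul_pos hr hs, ?_⟩
  rw [show -((phase g a + phase g b : ℝ) * Complex.I) = -((phase g a : ℝ) * Complex.I) +
    -((phase g b : ℝ) * Complex.I) by push_cast; ring, Complex.exp_add, e, f]
  generalize Complex.exp _ = u
  generalize Complex.exp _ = v
  push_cast
  linear_combination (r * s * u * v : ℂ) * Complex.I_sq

theorem pairPotential_mul_eq (hg : 0 < g) {a b : ℝ} (hab : 0 < Real.sin a * Real.sin b) :
    ∃ r : ℝ, 0 < r ∧ pairPotential g a * pairPotential g b =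
      r * -1 * Complex.exp (-((phase g a + phase g b : ℝ) * Complex.I)) := by
  obtain ⟨r, hr, e⟩ := sin_add_mul_sin_add_eq hg a b
  refine ⟨r / (Real.sin a * Real.sin b), div_pos hr hab, ?_⟩
  rw [pairPotential, pairPotential, div_mul_div_comm, e]
  push_cast
  ring

theorem pairPotential_mul_eq_of_neg (hg : 0 < g) {a b : ℝ} (hab : Real.sin a * Real.sin b < 0) :
    ∃ r : ℝ, 0 < r ∧ pairPotential g a * pairPotential g b =
      r * 1 * Complex.exp (-((phase g a + phase g b : ℝ) * Complex.I)) := by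
  obtain ⟨r, hr, e⟩ := sin_add_mul_sin_add_eq hg a b
  refine ⟨-r / (Real.sin a * Real.sin b), div_pos_of_neg_of_neg (neg_neg_of_pos hr) hab, ?_⟩
  rw [pairPotential, pairPotential, div_mul_div_comm, e]
  push_cast
  ring

/-- The two sine numerators contribute `i² = -1`. The denominator is positive for `k < j` and
negative for `k > j`, so a sign survives only for the `j` smaller indices. -/
theorem prod_pairPotential_eq (hg : 0 < g) {x : Fin n → ℝ} (hx : StrictMono x)
    (hx' : ∀ j, 0 < x j ∧ x j < Real.pi / 2) (j : Fin n) :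
    ∃ r : ℝ, 0 < r ∧ ∏ k ∈ Finset.univ.erase j,
        (pairPotential g ((x j : ℂ) + x k) * pairPotential g ((x j : ℂ) - x k)) =
      r * (-1) ^ (j : ℕ) * Complex.exp (-((∑ k ∈ Finset.univ.erase j,
        (phase g (x j + x k) + phase g (x j - x k)) : ℝ) * Complex.I)) := by
  have factor : ∀ k, k ≠ j → ∃ r : ℝ, 0 < r ∧
      pairPotential g ((x j : ℂ) + x k) * pairPotential g ((x j : ℂ) - x k) =
        r * (if k < j then -1 else 1) *
          Complex.exp (-((phase g (x j + x k) + phase g (x j - x k) : ℝ) * Complex.I)) := by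
    intro k hk
    have hj := hx' j
    have hk' := hx' k
    have hplus : 0 < Real.sin (x j + x k) :=
      Real.sin_pos_of_pos_of_lt_pi (by linarith) (by linarith)
    rw [← Complex.ofReal_add, ← Complex.ofReal_sub]
    split_ifs with h
    · have := hx h
      exact pairPotential_mul_eq hg (mul_pos hplus
        (Real.sin_pos_of_pos_of_lt_pi (by linarith) (by linarith)))
    · have := hx (lt_of_le_of_ne (not_lt.1 h) hk.symm)
      exact pairPotential_mul_eq_of_neg hg (mul_neg_of_pos_of_neg hplus
        (Real.sin_neg_of_neg_of_neg_pi_lt (by linarith) (by linarith)))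
  choose! r hr hfac using factor
  refine ⟨∏ k ∈ Finset.univ.erase j, r k,
    Finset.prod_pos fun k hk => hr k (Finset.ne_of_mem_erase hk), ?_⟩
  rw [Finset.prod_congr rfl fun k hk => hfac k (Finset.ne_of_mem_erase hk),
    Finset.prod_mul_distrib, Finset.prod_mul_distrib, ← Complex.exp_sum, Finset.sum_neg_distrib,
    ← Finset.sum_mul, Finset.prod_ite, Finset.prod_const_one, Finset.prod_const, mul_one]
  have hcard : (Finset.filter (fun k => k < j) (Finset.univ.erase j)) = Finset.Iio j := by
    ext k
    simp only [Finset.mem_filter, Finset.mem_erase, Finset.mem_univ, Finset.mem_Iio]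
    exact ⟨fun h => h.2, fun h => ⟨⟨h.ne, trivial⟩, h⟩⟩
  rw [hcard, Fin.card_Iio]
  push_cast
  rfl

theorem extPotential_eq (hg₁ : 0 < g₁) (hg₂ : 0 < g₂) (hg₃ : 0 < g₃) (hg₄ : 0 < g₄) {x : ℝ}
    (hx : 0 < x ∧ x < Real.pi / 2) : ∃ r : ℝ, 0 < r ∧ extPotential g₁ g₂ g₃ g₄ x =
      -r * Complex.exp (-(extPhase g₁ g₂ g₃ g₄ x * Complex.I)) := by
  obtain ⟨r, hr, e⟩ := ext_numerator_eq hg₁ hg₂ hg₃ hg₄ x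
  have hs : 0 < Real.sin x := Real.sin_pos_of_pos_of_lt_pi hx.1 (by linarith [Real.pi_pos])
  have hc : 0 < Real.cos x := Real.cos_pos_of_mem_Ioo ⟨by linarith, hx.2⟩
  refine ⟨r / (Real.sin x ^ 2 * Real.cos x ^ 2), by positivity, ?_⟩
  rw [extPotential, e]
  push_cast
  ring

theorem V_eq (hg : 0 < g) (hg₁ : 0 < g₁) (hg₂ : 0 < g₂) (hg₃ : 0 < g₃) (hg₄ : 0 < g₄)
    {x : Fin n → ℝ} (hx : StrictMono x) (hx' : ∀ j, 0 < x j ∧ x j < Real.pi / 2) (j : Fin n) :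
    ∃ r : ℝ, 0 < r ∧ V g g₁ g₂ g₃ g₄ j x = r * Complex.exp (((Real.pi * (j + 1) -
      bethePhase (phase g) (extPhase g₁ g₂ g₃ g₄) x j : ℝ) : ℂ) * Complex.I) := by
  obtain ⟨r, hr, e⟩ := prod_pairPotential_eq hg hx hx' j
  obtain ⟨s, hs, f⟩ := extPotential_eq hg₁ hg₂ hg₃ hg₄ (hx' j)
  refine ⟨r * s, mul_pos hr hs, ?_⟩
  rw [V, e, f, bethePhase]
  set S := ∑ k ∈ Finset.univ.erase j, (phase g (x j + x k) + phase g (x j - x k))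
  -- The pair product supplies `(-1)^j` and the external factor one more sign, so the total is
  -- `exp(iπ(j+1))`.
  have h : (((Real.pi * (j + 1) - (extPhase g₁ g₂ g₃ g₄ (x j) + S) : ℝ) : ℂ) * Complex.I) =
      ((j + 1 : ℕ) : ℂ) * (Real.pi * Complex.I) +
        -(extPhase g₁ g₂ g₃ g₄ (x j) * Complex.I) + -(S * Complex.I) := by
    push_cast
    ring
  rw [h, Complex.exp_add, Complex.exp_add, Complex.exp_nat_mul, Complex.exp_pi_mul_I, pow_succ]
  push_cast
  ring

theorem mul_conj_cpow_half (z : ℂ) : (z * (starRingEnd ℂ) z) ^ (1 / 2 : ℂ) = (‖z‖ : ℂ) := by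
  rw [Complex.mul_conj, Complex.normSq_eq_norm_sq, show (1 / 2 : ℂ) = ((1 / 2 : ℝ) : ℂ) by norm_num,
    ← Complex.ofReal_cpow (by positivity), ← Real.sqrt_eq_rpow, Real.sqrt_sq (norm_nonneg _)]

theorem hamiltonian_eq (p x : Fin n → ℝ) : hamiltonian g g₁ g₂ g₃ g₄ p x =
    ((∑ j, (Real.cosh (p j) * ‖V g g₁ g₂ g₃ g₄ j x‖ - (V g g₁ g₂ g₃ g₄ j x).re) : ℝ) : ℂ) := by
  rw [hamiltonian, Complex.ofReal_sum]
  refine Finset.sum_congr rfl fun j _ => ?_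
  rw [V_neg, mul_conj_cpow_half, Complex.add_conj]
  push_cast
  ring

theorem cosh_mul_norm_sub_re_nonneg (p : ℝ) (z : ℂ) : 0 ≤ Real.cosh p * ‖z‖ - z.re :=
  sub_nonneg.2 ((Complex.re_le_norm z).trans
    (le_mul_of_one_le_left (norm_nonneg z) (Real.one_le_cosh p)))

theorem cosh_mul_norm_sub_re_eq_zero_iff {r : ℝ} (hr : 0 < r) (p θ : ℝ) :
    Real.cosh p * ‖(r : ℂ) * Complex.exp (θ * Complex.I)‖ -
      ((r : ℂ) * Complex.exp (θ * Complex.I)).re = 0 ↔ p = 0 ∧ Real.cos θ = 1 := by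
  rw [norm_mul, Complex.norm_exp_ofReal_mul_I, Complex.norm_real, Real.norm_of_nonneg hr.le,
    Complex.re_ofReal_mul, Complex.exp_ofReal_mul_I_re, mul_one, mul_comm, ← mul_sub,
    mul_eq_zero, or_iff_right hr.ne', sub_eq_zero]
  constructor
  · intro h
    have h1 := Real.cos_le_one θ
    have h2 := Real.one_le_cosh p
    have h3 : Real.cos θ = 1 := by linarith
    refine ⟨?_, h3⟩
    by_contra hp
    linarith [Real.one_lt_cosh.2 hp]
  · rintro ⟨rfl, h⟩
    rw [h, Real.cosh_zero]

theorem hamiltonian_eq_zero_iff_cos (hg : 0 < g) (hg₁ : 0 < g₁) (hg₂ : 0 < g₂) (hg₃ : 0 < g₃)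
    (hg₄ : 0 < g₄) (p : Fin n → ℝ) {x : Fin n → ℝ} (hx : StrictMono x)
    (hx' : ∀ j, 0 < x j ∧ x j < Real.pi / 2) :
    hamiltonian g g₁ g₂ g₃ g₄ p x = 0 ↔ p = 0 ∧ ∀ j : Fin n, Real.cos (Real.pi * (j + 1) -
      bethePhase (phase g) (extPhase g₁ g₂ g₃ g₄) x j) = 1 := by
  rw [hamiltonian_eq, Complex.ofReal_eq_zero, Finset.sum_eq_zero_iff_of_nonneg
    fun j _ => cosh_mul_norm_sub_re_nonneg _ _, funext_iff, ← forall_and]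
  refine forall_congr' fun j => ?_
  obtain ⟨r, hr, e⟩ := V_eq hg hg₁ hg₂ hg₃ hg₄ hx hx' j
  rw [e, cosh_mul_norm_sub_re_eq_zero_iff hr]
  simp

theorem conj_exp_neg_mul_I (t : ℝ) : (starRingEnd ℂ) (Complex.exp (-(t * Complex.I))) =
    Complex.exp (t * Complex.I) := by
  rw [← Complex.exp_conj]
  simp [Complex.conj_ofReal]

theorem ratio_conj_exp {r : ℝ} (hr : r ≠ 0) (t : ℝ) :
    (r * Complex.exp (-(t * Complex.I))) /
      (starRingEnd ℂ) (r * Complex.exp (-(t * Complex.I))) =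
      Complex.exp (-(2 * t * Complex.I)) := by
  rw [map_mul, Complex.conj_ofReal, conj_exp_neg_mul_I,
    mul_div_mul_left _ _ (Complex.ofReal_ne_zero.2 hr), ← Complex.exp_sub]
  congr 1
  ring

theorem sin_pair_ratio (hg : 0 < g) (a b : ℝ) :
    (Complex.sin (a + Complex.I * g) * Complex.sin (b + Complex.I * g)) /
      (Complex.sin (a - Complex.I * g) * Complex.sin (b - Complex.I * g)) =
      Complex.exp (-(2 * (phase g a + phase g b : ℝ) * Complex.I)) := by
  obtain ⟨r, hr, h⟩ := sin_add_mul_sin_add_eq hg a b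
  rw [sin_sub_eq_conj, sin_sub_eq_conj, ← map_mul, h, ratio_conj_exp (neg_ne_zero.2 hr.ne')]

theorem ext_numerator_ratio (hg₁ : 0 < g₁) (hg₂ : 0 < g₂) (hg₃ : 0 < g₃) (hg₄ : 0 < g₄)
    (x : ℝ) :
    (Complex.sin (x - Complex.I * g₁) * Complex.cos (x - Complex.I * g₂) *
        Complex.sin (x - Complex.I * g₃) * Complex.cos (x - Complex.I * g₄)) /
      (Complex.sin (x + Complex.I * g₁) * Complex.cos (x + Complex.I * g₂) *
        Complex.sin (x + Complex.I * g₃) * Complex.cos (x + Complex.I * g₄)) =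
      Complex.exp (2 * extPhase g₁ g₂ g₃ g₄ x * Complex.I) := by
  obtain ⟨r, hr, e⟩ := ext_numerator_eq hg₁ hg₂ hg₃ hg₄ x
  rw [← Complex.ofReal_neg] at e
  rw [sin_sub_eq_conj, cos_sub_eq_conj, sin_sub_eq_conj, cos_sub_eq_conj, ← map_mul, ← map_mul,
    ← map_mul, e, ← inv_div, ratio_conj_exp (neg_ne_zero.2 hr.ne'), ← Complex.exp_neg, neg_neg]

/-- Each side is built from quotients of a number and its conjugate, which double the phase; hence
`Ξ_j` is constrained only modulo `π`. -/
theorem isBetheSolution_iff (hg : 0 < g) (hg₁ : 0 < g₁) (hg₂ : 0 < g₂) (hg₃ : 0 < g₃)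
    (hg₄ : 0 < g₄) (x : Fin n → ℝ) :
    IsBetheSolution g g₁ g₂ g₃ g₄ x ↔ ∀ j, ∃ m : ℤ,
      bethePhase (phase g) (extPhase g₁ g₂ g₃ g₄) x j = Real.pi * m := by
  refine forall_congr' fun j => ?_
  rw [ext_numerator_ratio hg₁ hg₂ hg₃ hg₄, Finset.prod_congr rfl fun k _ => by
    rw [← Complex.ofReal_add, ← Complex.ofReal_sub, sin_pair_ratio hg], ← Complex.exp_sum,
    eq_comm, Complex.exp_eq_exp_iff_exists_int]
  refine exists_congr fun m => ?_
  rw [Finset.sum_neg_distrib, ← Finset.sum_mul, ← Finset.mul_sum, ← Complex.ofReal_sum,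
    bethePhase]
  set S := ∑ k ∈ Finset.univ.erase j, (phase g (x j + x k) + phase g (x j - x k))
  set w := extPhase g₁ g₂ g₃ g₄ (x j)
  rw [← Complex.ofReal_inj]
  push_cast
  constructor
  · intro h
    have h2 : (2 * Complex.I) * ((w : ℂ) + S) = (2 * Complex.I) * (Real.pi * m) := by
      linear_combination h
    exact mul_left_cancel₀ (mul_ne_zero two_ne_zero Complex.I_ne_zero) h2
  · intro h
    linear_combination (2 * Complex.I) * h

/-- Vanishing fixes `Ξ_j` modulo `2π`, formally more than the Bethe equations do. In the alcove
integrality of `Ξ_j / π` already determines `Ξ_j`, so the parity can be discarded. -/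
theorem hamiltonian_eq_zero_iff (hg : 0 < g) (hg₁ : 0 < g₁) (hg₂ : 0 < g₂) (hg₃ : 0 < g₃)
    (hg₄ : 0 < g₄) (p : Fin n → ℝ) {x : Fin n → ℝ} (hx : StrictMono x)
    (hx' : ∀ j, 0 < x j ∧ x j < Real.pi / 2) :
    hamiltonian g g₁ g₂ g₃ g₄ p x = 0 ↔ p = 0 ∧ ∀ j : Fin n,
      bethePhase (phase g) (extPhase g₁ g₂ g₃ g₄) x j = Real.pi * (j + 1) := by
  rw [hamiltonian_eq_zero_iff_cos hg hg₁ hg₂ hg₃ hg₄ p hx hx']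
  refine and_congr_right fun _ => ⟨fun h => ?_, fun h j => by rw [h, sub_self, Real.cos_zero]⟩
  refine bethePhase_eq_of_int (phase_neg hg) (strictMono_phase hg).monotone (phase_add_pi g)
    (extPhase_neg hg₁ hg₂ hg₃ hg₄) (strictMono_extPhase hg₁ hg₂ hg₃ hg₄)
    (extPhase_half_pi hg₁ hg₂ hg₃ hg₄) hx hx' fun j => ?_
  obtain ⟨m, hm⟩ := (Real.cos_eq_one_iff _).1 (h j)
  refine ⟨j + 1 - 2 * m, ?_⟩
  push_cast
  linarith

theorem isBetheSolution_iff_of_mem (hg : 0 < g) (hg₁ : 0 < g₁) (hg₂ : 0 < g₂) (hg₃ : 0 < g₃)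
    (hg₄ : 0 < g₄) {x : Fin n → ℝ} (hx : StrictMono x)
    (hx' : ∀ j, 0 < x j ∧ x j < Real.pi / 2) :
    IsBetheSolution g g₁ g₂ g₃ g₄ x ↔ ∀ j : Fin n,
      bethePhase (phase g) (extPhase g₁ g₂ g₃ g₄) x j = Real.pi * (j + 1) := by
  rw [isBetheSolution_iff hg hg₁ hg₂ hg₃ hg₄]
  exact ⟨bethePhase_eq_of_int (phase_neg hg) (strictMono_phase hg).monotone (phase_add_pi g)
    (extPhase_neg hg₁ hg₂ hg₃ hg₄) (strictMono_extPhase hg₁ hg₂ hg₃ hg₄)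
    (extPhase_half_pi hg₁ hg₂ hg₃ hg₄) hx hx', fun h j => ⟨j + 1, by rw [h]; push_cast; rfl⟩⟩

end Potentials

end RuijsenaarsBC

theorem theorem1 (n : ℕ) (g g₁ g₂ g₃ g₄ : ℝ)
    (hg : 0 < g) (hg₁ : 0 < g₁) (hg₂ : 0 < g₂) (hg₃ : 0 < g₃) (hg₄ : 0 < g₄) :
    (∀ P ∈ RuijsenaarsBC.phaseSpace n,
      (RuijsenaarsBC.hamiltonian g g₁ g₂ g₃ g₄ P.1 P.2).im = 0 ∧
      0 ≤ (RuijsenaarsBC.hamiltonian g g₁ g₂ g₃ g₄ P.1 P.2).re) ∧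
    (∀ P ∈ RuijsenaarsBC.phaseSpace n,
      (RuijsenaarsBC.hamiltonian g g₁ g₂ g₃ g₄ P.1 P.2 = 0 ↔
        P.1 = 0 ∧ RuijsenaarsBC.IsBetheSolution g g₁ g₂ g₃ g₄ P.2)) ∧
    (∃! P : (Fin n → ℝ) × (Fin n → ℝ), P ∈ RuijsenaarsBC.phaseSpace n ∧
      RuijsenaarsBC.hamiltonian g g₁ g₂ g₃ g₄ P.1 P.2 = 0) := by

  open RuijsenaarsBC in
  refine ⟨fun P _ => ?_, fun P hP => ?_, ?_⟩
  · rw [hamiltonian_eq]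
    refine ⟨Complex.ofReal_im _, ?_⟩
    rw [Complex.ofReal_re]
    exact Finset.sum_nonneg fun j _ => cosh_mul_norm_sub_re_nonneg _ _
  · rw [hamiltonian_eq_zero_iff hg hg₁ hg₂ hg₃ hg₄ P.1 hP.1 hP.2,
      isBetheSolution_iff_of_mem hg hg₁ hg₂ hg₃ hg₄ hP.1 hP.2]
  · obtain ⟨x, hx, hx', heq⟩ := exists_bethePhase_eq (n := n) (phase_neg hg)
      (strictMono_phase hg).monotone (continuous_phase hg) (phase_add_pi g)
      (extPhase_neg hg₁ hg₂ hg₃ hg₄) (strictMono_extPhase hg₁ hg₂ hg₃ hg₄)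
      (continuous_extPhase hg₁ hg₂ hg₃ hg₄) (extPhase_half_pi hg₁ hg₂ hg₃ hg₄)
    refine ⟨(0, x), ⟨⟨hx, hx'⟩, (hamiltonian_eq_zero_iff hg hg₁ hg₂ hg₃ hg₄ 0 hx hx').2
      ⟨rfl, heq⟩⟩, fun P hP => ?_⟩
    have h := (hamiltonian_eq_zero_iff hg hg₁ hg₂ hg₃ hg₄ P.1 hP.1.1 hP.1.2).1 hP.2
    refine Prod.ext h.1 (bethePhase_injective (phase_neg hg) (strictMono_phase hg).monotone
      (strictMono_extPhase hg₁ hg₂ hg₃ hg₄) (funext fun j => ?_))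
    rw [h.2 j]
    exact (heq j).symm
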